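/- Let $A\in\mathbb{R}^{n\times n}$, $C\in\mathbb{R}^{p\times n}$, $Q_w\in\mathbb{R}^{n\times n}$, $S_{wv}\in\mathbb{R}^{n\times p}$ and $R_v\in\mathbb{R}^{p\times p}$ with $R_v\succ 0$ (symmetric positive definite), and let $$\begin{bmatrix} Q_w & S_{wv}\\ S_{wv}^\top & R_v\end{bmatrix}=\begin{bmatrix}\tilde B\\ \tilde D\end{bmatrix}\begin{bmatrix}\tilde B^\top & \tilde D^\top\end{bmatrix}$$ be a full rank factorization, where $\tilde B\in\mathbb{R}^{n\times r}$, $\tilde D\in\mathbb{R}^{p\times r}$ and $\begin{bmatrix}\tilde B\\ \tilde D\end{bmatrix}$ has rank $r$. For $P\succeq 0$ (symmetric positive semidefinite) put $R(P)=CPC^\top+R_v$ and $K(P)=(APC^\top+S_{wv})R(P)^{-1}$. Consider the discrete algebraic Riccati equation (DARE) $$P=APA^\top+Q_w-(APC^\top+S_{wv})(CPC^\top+R_v)^{-1}(APC^\top+S_{wv})^\top,$$ and, for $\hat P_0\succeq 0$, the error covariances $$\hat P_{k+1}=A\hat P_kA^\top+Q_w-K(\hat P_k)R(\hat P_k)K(\hat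 P_k)^\top,\qquad k\ge 0.$$ A real square matrix is called stable if its spectral radius is less than $1$; a solution $P$ of the DARE is stabilizing if $A-K(P)C$ is stable; $(A,C)$ is detectable if $A-LC$ is stable for some real matrix $L$; $(A,B)$ is stabilizable if $A-BG$ is stable for some real matrix $G$. Then the following are equivalent: (i) the DARE has exactly one solution $\hat P\succeq 0$, and this solution is stabilizing; (ii) there is a matrix $\hat P$ such that, for every $\hat P_0\succeq 0$, $\hat P_k\to\hat P$ exponentially fast, that is, there are $c\ge 0$ and $\rho\in[0,1)$ (which may depend on $\hat P_0$) with $\|\hat P_k-\hat P\|\le c\rho^k$ for all $k\ge 0$; (iii) $(A,C)$ is detectable, and $(A-FC,\tilde B-F\tilde D)$ is stabilizable for every $F\in\mathbb{R}^{n\times p}$. Moreover, when these hold, the limit $\hat P$ in (ii) is the unique positive semidefinite solution of the DARE in (i). -/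

import Mathlib

open Matrix

namespace KalmanFilter

/-- Schur stability of a real square matrix: the spectral radius, taken over its complex
eigenvalues, is less than one. -/
def IsSchurStable {n : ℕ} (A : Matrix (Fin n) (Fin n) ℝ) : Prop :=
  spectralRadius ℂ (A.map (algebraMap ℝ ℂ)) < 1

/-- `(A, B)` is stabilizable: some state feedback makes the closed loop Schur stable. -/
def IsStabilizable {n m : ℕ} (A : Matrix (Fin n) (Fin n) ℝ) (B : Matrix (Fin n) (Fin m) ℝ) :
    Prop :=
  ∃ K : Matrix (Fin m) (Fin n) ℝ, IsSchurStable (A - B * K)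

/-- `(A, C)` is detectable: some output injection makes the error dynamics Schur stable. -/
def IsDetectable {n p : ℕ} (A : Matrix (Fin n) (Fin n) ℝ) (C : Matrix (Fin p) (Fin n) ℝ) :
    Prop :=
  ∃ L : Matrix (Fin n) (Fin p) ℝ, IsSchurStable (A - L * C)

section Riccati

variable {n p : ℕ}

/-- The innovation covariance `C P Cᵀ + R`. -/
def innovationCov (C : Matrix (Fin p) (Fin n) ℝ) (R : Matrix (Fin p) (Fin p) ℝ)
    (P : Matrix (Fin n) (Fin n) ℝ) : Matrix (Fin p) (Fin p) ℝ :=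
  C * P * Cᵀ + R

/-- The filter gain `(A P Cᵀ + S) (C P Cᵀ + R)⁻¹`. -/
noncomputable def gain (A : Matrix (Fin n) (Fin n) ℝ) (C : Matrix (Fin p) (Fin n) ℝ)
    (S : Matrix (Fin n) (Fin p) ℝ) (R : Matrix (Fin p) (Fin p) ℝ)
    (P : Matrix (Fin n) (Fin n) ℝ) : Matrix (Fin n) (Fin p) ℝ :=
  (A * P * Cᵀ + S) * (innovationCov C R P)⁻¹

/-- The error covariances of the time-varying filter started at `P₀`:
`P_{k+1} = A P_k Aᵀ + Q - K_k R_k K_kᵀ`, where `R_k` is the innovation covariance and `K_k`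
the gain at `P_k`. -/
noncomputable def errorCov (A : Matrix (Fin n) (Fin n) ℝ) (C : Matrix (Fin p) (Fin n) ℝ)
    (Q : Matrix (Fin n) (Fin n) ℝ) (S : Matrix (Fin n) (Fin p) ℝ)
    (R : Matrix (Fin p) (Fin p) ℝ) (P₀ : Matrix (Fin n) (Fin n) ℝ) :
    ℕ → Matrix (Fin n) (Fin n) ℝ
  | 0 => P₀
  | k + 1 =>
    let P := errorCov A C Q S R P₀ k
    A * P * Aᵀ + Q - gain A C S R P * innovationCov C R P * (gain A C S R P)ᵀ

/-- The discrete algebraic Riccati equation of the filter. -/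
def SolvesDARE (A : Matrix (Fin n) (Fin n) ℝ) (C : Matrix (Fin p) (Fin n) ℝ)
    (Q : Matrix (Fin n) (Fin n) ℝ) (S : Matrix (Fin n) (Fin p) ℝ)
    (R : Matrix (Fin p) (Fin p) ℝ) (P : Matrix (Fin n) (Fin n) ℝ) : Prop :=
  P = A * P * Aᵀ + Q - (A * P * Cᵀ + S) * (C * P * Cᵀ + R)⁻¹ * (A * P * Cᵀ + S)ᵀ

/-- `P` is the only positive semidefinite solution of the DARE, and it is stabilizing, that is,
`A - K C` is Schur stable for the gain `K` at `P`. -/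
def IsUniqueStabilizingSolution (A : Matrix (Fin n) (Fin n) ℝ) (C : Matrix (Fin p) (Fin n) ℝ)
    (Q : Matrix (Fin n) (Fin n) ℝ) (S : Matrix (Fin n) (Fin p) ℝ)
    (R : Matrix (Fin p) (Fin p) ℝ) (P : Matrix (Fin n) (Fin n) ℝ) : Prop :=
  P.PosSemidef ∧ SolvesDARE A C Q S R P ∧ IsSchurStable (A - gain A C S R P * C) ∧
    ∀ P' : Matrix (Fin n) (Fin n) ℝ, P'.PosSemidef → SolvesDARE A C Q S R P' → P' = P

open scoped Matrix.Norms.L2Operator in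
/-- A sequence of matrices converges to `P` exponentially fast (in the spectral norm). -/
def ConvergesExponentially (X : ℕ → Matrix (Fin n) (Fin n) ℝ) (P : Matrix (Fin n) (Fin n) ℝ) :
    Prop :=
  ∃ c ρ : ℝ, 0 ≤ c ∧ 0 ≤ ρ ∧ ρ < 1 ∧ ∀ k : ℕ, ‖X k - P‖ ≤ c * ρ ^ k

/-- From every positive semidefinite initial value, the error covariances converge
exponentially fast to `P`. -/
def ErrorCovConvergesTo (A : Matrix (Fin n) (Fin n) ℝ) (C : Matrix (Fin p) (Fin n) ℝ)
    (Q : Matrix (Fin n) (Fin n) ℝ) (S : Matrix (Fin n) (Fin p) ℝ)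
    (R : Matrix (Fin p) (Fin p) ℝ) (P : Matrix (Fin n) (Fin n) ℝ) : Prop :=
  ∀ P₀ : Matrix (Fin n) (Fin n) ℝ, P₀.PosSemidef →
    ConvergesExponentially (errorCov A C Q S R P₀) P

end Riccati

end KalmanFilter

/-! Write `M = A - K(P) C` and `N = B - K(P) D` for a positive semidefinite fixed point `P` of
the Riccati map, so that `P = M P Mᵀ + N Nᵀ`. A matrix `M` fails to be Schur stable exactly when
there is a positive semidefinite weight `W ≠ 0` with `W ≤ Mᵀ W M`.

* (iii) ⇒ (i), (ii): by detectability the covariances started at `0` increase to a fixed point `P`.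
  A weight for `M` satisfies `W N = 0`, hence is a weight for every `M - N G`, contradicting
  stabilizability. So `M` is stable, and a Lyapunov function for `M` contracts the difference of two
  error covariances once the closed loops are close to `M`.
* (i) ⇒ (iii): for any gain `F`, the Joseph form with the two gains `F` and `K(P_k)` reads
  `P_{k+1} = (A - F C) P_k (A - K(P_k) C)ᵀ + (B - F D) (B - K(P_k) D)ᵀ`, so along the orbit of `0`
  the columns of `K(P_k) - F` are reachable for `(A - F C, B - F D)`. For large `k` the matrix
  `(A - F C) - (K(P_k) - F) C` is stable, and a stable matrix that differs from the system matrix by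
  reachable columns can be replaced by one obtained by state feedback.
* (ii) ⇒ (iii): it remains to see that `M` is stable. If `W` is a weight for `M`, then
  `d_k = tr (W (P_k - P))`, started at `P + 1`, satisfies `d_k ≤ (1 + ε_k) d_{k+1}` with
  `ε_k` proportional to `‖P_k - P‖`, which is summable by the exponential rate; hence `d_k` cannot
  tend to `0`.
-/

namespace KalmanFilter

open Filter Topology
open scoped Matrix.Norms.L2Operator MatrixOrder

section PosSemidef

variable {ι κ : Type*} [Fintype ι]

theorem posSemidef_mul_transpose_self [Finite κ] (N : Matrix κ ι ℝ) : (N * Nᵀ).PosSemidef := by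
  simpa using posSemidef_self_mul_conjTranspose N

theorem posSemidef_mul_mul_transpose [Finite κ] {X : Matrix ι ι ℝ} (hX : X.PosSemidef)
    (N : Matrix κ ι ℝ) : (N * X * Nᵀ).PosSemidef := by
  simpa using hX.mul_mul_conjTranspose_same N

theorem posSemidef_transpose_mul_mul [Finite κ] {X : Matrix ι ι ℝ} (hX : X.PosSemidef)
    (N : Matrix ι κ ℝ) : (Nᵀ * X * N).PosSemidef := by
  simpa using hX.conjTranspose_mul_mul_same N

theorem mul_mul_transpose_mono [Finite κ] {X Y : Matrix ι ι ℝ} (h : X ≤ Y) (N : Matrix κ ι ℝ) :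
    N * X * Nᵀ ≤ N * Y * Nᵀ := by
  rw [le_iff, ← Matrix.sub_mul, ← Matrix.mul_sub]
  exact posSemidef_mul_mul_transpose h N

theorem trace_mono {X Y : Matrix ι ι ℝ} (h : X ≤ Y) : X.trace ≤ Y.trace :=
  OrderHomClass.mono (tracePositiveLinearMap ι ℝ ℝ) h

theorem exists_eq_transpose_mul_self {X : Matrix ι ι ℝ} (hX : X.PosSemidef) :
    ∃ V : Matrix ι ι ℝ, X = Vᵀ * V := by
  classical
  have hsqrt := (CFC.sqrt_nonneg X).posSemidef.isHermitian.eq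
  rw [conjTranspose_eq_transpose_of_trivial] at hsqrt
  exact ⟨CFC.sqrt X, by rw [hsqrt, CFC.sqrt_mul_sqrt_self X hX.nonneg]⟩

theorem trace_mul_mul_mul_transpose (W M X : Matrix ι ι ℝ) :
    (W * (M * X * Mᵀ)).trace = (Mᵀ * W * M * X).trace := by
  rw [← Matrix.mul_assoc, Matrix.trace_mul_comm]
  simp only [Matrix.mul_assoc]

theorem trace_mul_mono {W X Y : Matrix ι ι ℝ} (hW : W.PosSemidef) (h : X ≤ Y) :
    (W * X).trace ≤ (W * Y).trace := by
  classical
  obtain ⟨V, rfl⟩ := exists_eq_transpose_mul_self hW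
  have trace_conj (Z : Matrix ι ι ℝ) : (V * Z * Vᵀ).trace = (Vᵀ * V * Z).trace := by
    simpa using trace_mul_mul_mul_transpose 1 V Z
  simpa only [trace_conj] using trace_mono (mul_mul_transpose_mono h V)

theorem trace_mul_nonneg {W X : Matrix ι ι ℝ} (hW : W.PosSemidef) (hX : X.PosSemidef) :
    0 ≤ (W * X).trace := by
  simpa using trace_mul_mono hW hX.nonneg

theorem mul_eq_zero_of_trace_mul_mul_transpose_eq_zero [Fintype κ] {W : Matrix ι ι ℝ}
    (hW : W.PosSemidef) {N : Matrix ι κ ℝ} (h : (W * (N * Nᵀ)).trace = 0) : W * N = 0 := by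
  obtain ⟨V, rfl⟩ := exists_eq_transpose_mul_self hW
  have hVN : V * N = 0 := by
    rw [← trace_mul_conjTranspose_self_eq_zero_iff, conjTranspose_eq_transpose_of_trivial,
      transpose_mul, ← h, Matrix.mul_assoc Vᵀ, Matrix.trace_mul_comm Vᵀ]
    simp only [Matrix.mul_assoc]
  rw [Matrix.mul_assoc, hVN, Matrix.mul_zero]

theorem add_mul_mul_transpose_add_le [Finite κ] {X : Matrix ι ι ℝ} (hX : X.PosSemidef)
    (U V : Matrix κ ι ℝ) {ε : ℝ} (hε : 0 < ε) :
    (U + V) * X * (U + V)ᵀ ≤ (1 + ε) • (U * X * Uᵀ + ε⁻¹ • (V * X * Vᵀ)) := by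
  have hdiff : (1 + ε) • (U * X * Uᵀ + ε⁻¹ • (V * X * Vᵀ)) - (U + V) * X * (U + V)ᵀ =
      ε • ((U - ε⁻¹ • V) * X * (U - ε⁻¹ • V)ᵀ) := by
    simp only [transpose_add, transpose_sub, transpose_smul, Matrix.add_mul, Matrix.sub_mul,
      Matrix.mul_add, Matrix.mul_sub, Matrix.smul_mul, Matrix.mul_smul]
    match_scalars <;> field_simp <;> ring
  rw [le_iff, hdiff]
  exact (posSemidef_mul_mul_transpose hX _).smul hε.le

variable [DecidableEq ι]

theorem le_norm_smul_one {X : Matrix ι ι ℝ} (hX : X.IsHermitian) : X ≤ ‖X‖ • 1 := by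
  have hX' : IsSelfAdjoint X := hX
  rw [← Algebra.algebraMap_eq_smul_one]
  refine le_algebraMap_of_spectrum_le fun x hx => (le_abs_self x).trans ?_
  simpa [cfc_id ℝ X] using norm_apply_le_norm_cfc (id : ℝ → ℝ) X hx

theorem norm_le_trace {X : Matrix ι ι ℝ} (hX : X.PosSemidef) : ‖X‖ ≤ X.trace := by
  have hX' : IsSelfAdjoint X := hX.isHermitian
  suffices ‖cfc id X‖ ≤ X.trace by rwa [cfc_id ℝ X] at this
  refine norm_cfc_le hX.trace_nonneg fun x hx => ?_
  rw [hX.isHermitian.spectrum_real_eq_range_eigenvalues] at hx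
  obtain ⟨i, rfl⟩ := hx
  rw [hX.isHermitian.trace_eq_sum_eigenvalues, id, Real.norm_of_nonneg (hX.eigenvalues_nonneg i)]
  exact Finset.single_le_sum (f := hX.isHermitian.eigenvalues)
    (fun j _ => hX.eigenvalues_nonneg j) (Finset.mem_univ i)

end PosSemidef

section LoewnerOrder

variable {ι : Type*} [Finite ι]

instance instOrderClosedTopologyMatrix : OrderClosedTopology (Matrix ι ι ℝ) where
  isClosed_le' := by
    have := Fintype.ofFinite ι
    simp only [le_iff, posSemidef_iff_dotProduct_mulVec, IsHermitian, Set.ofPred_and,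
      Set.ofPred_forall]
    refine (isClosed_eq ?_ ?_).inter (isClosed_iInter fun x => isClosed_le ?_ ?_) <;> fun_prop

theorem exists_tendsto_of_monotone_of_le {X : ℕ → Matrix ι ι ℝ} {Y : Matrix ι ι ℝ}
    (hX : Monotone X) (hY : ∀ k, X k ≤ Y) : ∃ P, Tendsto X atTop (𝓝 P) := by
  classical
  have := Fintype.ofFinite ι
  have htr : Monotone fun k => (X k).trace := fun _ _ hij => trace_mono (hX hij)
  have hbdd : BddAbove (Set.range fun k => (X k).trace) :=
    ⟨Y.trace, Set.forall_mem_range.mpr fun k => trace_mono (hY k)⟩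
  refine cauchySeq_tendsto_of_complete
    (cauchySeq_of_le_tendsto_0' (fun k => (⨆ j, (X j).trace) - (X k).trace) ?_ ?_)
  · intro k m hkm
    rw [dist_comm, dist_eq_norm]
    refine (norm_le_trace (hX hkm)).trans ?_
    rw [trace_sub]
    gcongr
    exact le_ciSup hbdd m
  · simpa using (tendsto_atTop_ciSup htr hbdd).const_sub (⨆ j, (X j).trace)

theorem exists_pos_one_le_smul [DecidableEq ι] {X : Matrix ι ι ℝ} (hX : X.PosDef) :
    ∃ c : ℝ, 0 < c ∧ 1 ≤ c • X := by
  have := Fintype.ofFinite ι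
  cases isEmpty_or_nonempty ι
  · exact ⟨1, one_pos, (Subsingleton.elim _ _).le⟩
  have hX' : IsSelfAdjoint X := hX.isHermitian
  obtain ⟨r, hr, hle⟩ := (CFC.exists_pos_algebraMap_le_iff (a := X)).mpr fun x hx => by
    rw [hX.isHermitian.spectrum_real_eq_range_eigenvalues] at hx
    obtain ⟨i, rfl⟩ := hx
    exact hX.eigenvalues_pos i
  refine ⟨r⁻¹, inv_pos.mpr hr, ?_⟩
  rw [Algebra.algebraMap_eq_smul_one] at hle
  simpa [smul_smul, inv_mul_cancel₀ hr.ne'] using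
    smul_le_smul_of_nonneg_left hle (inv_nonneg.mpr hr.le)

end LoewnerOrder

section SpectralRadius

variable {𝔸 : Type*} [NormedRing 𝔸] [NormedAlgebra ℂ 𝔸] [CompleteSpace 𝔸]

theorem summable_norm_pow_of_spectralRadius_lt_one {a : 𝔸} (ha : spectralRadius ℂ a < 1) :
    Summable fun k : ℕ => ‖a ^ k‖ := by
  obtain ⟨ρ, hρ, hρ1⟩ := ENNReal.lt_iff_exists_nnreal_btwn.mp ha
  have hgelfand := spectrum.pow_nnnorm_pow_one_div_tendsto_nhds_spectralRadius a
  refine Summable.of_norm_bounded_eventually_nat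
    (NNReal.summable_coe.mpr (NNReal.summable_geometric (by exact_mod_cast hρ1))) ?_
  filter_upwards [hgelfand.eventually_lt_const hρ, eventually_gt_atTop 0] with k hk hk0
  rw [one_div, ENNReal.rpow_inv_lt_iff (by positivity), ENNReal.rpow_natCast] at hk
  rw [norm_norm]
  exact_mod_cast hk.le

theorem isOpen_setOf_spectralRadius_lt_one : IsOpen {a : 𝔸 | spectralRadius ℂ a < 1} := by
  refine isOpen_iff_mem_nhds.mpr fun a ha => ?_
  have hlim : Tendsto (fun k : ℕ => ‖a ^ (k + 1)‖ * ‖(1 : 𝔸)‖) atTop (𝓝 0) := by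
    simpa using ((summable_norm_pow_of_spectralRadius_lt_one ha).tendsto_atTop_zero.comp
      (tendsto_add_atTop_nat 1)).mul_const ‖(1 : 𝔸)‖
  obtain ⟨k, hk⟩ := (hlim.eventually_lt_const one_pos).exists
  have hcont : Continuous fun x : 𝔸 => ‖x ^ (k + 1)‖ * ‖(1 : 𝔸)‖ := by fun_prop
  filter_upwards [(hcont.tendsto a).eventually_lt_const hk] with x hx
  refine (spectrum.spectralRadius_le_pow_nnnorm_pow_one_div ℂ x k).trans_lt ?_
  rw [← ENNReal.mul_rpow_of_nonneg _ _ (by positivity)]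
  exact ENNReal.rpow_lt_one (by exact_mod_cast hx) (by positivity)

end SpectralRadius

section SchurStability

variable {n : ℕ} {M N : Matrix (Fin n) (Fin n) ℝ}

theorem IsSchurStable.eventually_nhds (hM : IsSchurStable M) : ∀ᶠ X in 𝓝 M, IsSchurStable X := by
  have hcont : Continuous fun X : Matrix (Fin n) (Fin n) ℝ => X.map (algebraMap ℝ ℂ) :=
    continuous_id.matrix_map (continuous_algebraMap ℝ ℂ)
  exact (isOpen_setOf_spectralRadius_lt_one.preimage hcont).mem_nhds hM

theorem IsSchurStable.transpose (hM : IsSchurStable M) : IsSchurStable Mᵀ := by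
  have hspec : spectrum ℂ (Mᵀ.map (algebraMap ℝ ℂ)) = spectrum ℂ (M.map (algebraMap ℝ ℂ)) := by
    ext z
    rw [transpose_map, spectrum.mem_iff, spectrum.mem_iff, ← isUnit_transpose (A := _ - _)]
    simp [Algebra.algebraMap_eq_smul_one]
  rwa [IsSchurStable, spectralRadius, hspec]

theorem IsSchurStable.of_similar {T : Matrix (Fin n) (Fin n) ℝ} (hT : IsUnit T)
    (h : T * M = N * T) (hM : IsSchurStable M) : IsSchurStable N := by
  obtain ⟨u, rfl⟩ := hT
  let φ : Matrix (Fin n) (Fin n) ℝ →+* Matrix (Fin n) (Fin n) ℂ := (algebraMap ℝ ℂ).mapMatrix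
  let v := Units.map φ.toMonoidHom u
  have hN : φ N = v * φ M * (v⁻¹ : (Matrix (Fin n) (Fin n) ℂ)ˣ) := by
    rw [Units.eq_mul_inv_iff_mul_eq]
    exact (map_mul φ N u).symm.trans ((congrArg φ h.symm).trans (map_mul φ _ _))
  change spectralRadius ℂ (φ N) < 1
  rwa [hN, spectralRadius, spectrum.units_conjugate]

theorem IsSchurStable.summable_norm_pow (hM : IsSchurStable M) :
    Summable fun k : ℕ => ‖M ^ k‖ := by
  let re : Matrix (Fin n) (Fin n) ℂ →L[ℝ] Matrix (Fin n) (Fin n) ℝ :=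
    (Complex.reLm.mapMatrix).toContinuousLinearMap
  refine .of_nonneg_of_le (fun _ => norm_nonneg _) (fun k => ?_)
    ((summable_norm_pow_of_spectralRadius_lt_one hM).mul_left ‖re‖)
  have hre : M ^ k = re (M.map (algebraMap ℝ ℂ) ^ k) := by
    rw [← Matrix.map_pow]
    ext i j
    simp [re]
  rw [hre]
  exact re.le_opNorm _

theorem IsSchurStable.tendsto_pow (hM : IsSchurStable M) :
    Tendsto (fun k : ℕ => M ^ k) atTop (𝓝 0) :=
  tendsto_zero_iff_norm_tendsto_zero.mpr hM.summable_norm_pow.tendsto_atTop_zero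

theorem exists_vecMul_eq_smul_of_not_isSchurStable (hM : ¬ IsSchurStable M) :
    ∃ (z : ℂ) (v : Fin n → ℂ), 1 ≤ ‖z‖ ∧ v ≠ 0 ∧ v ᵥ* M.map (algebraMap ℝ ℂ) = z • v := by
  have hn : Nonempty (Fin n) := by
    by_contra hn
    have := not_nonempty_iff.mp hn
    exact hM (by simp [IsSchurStable, spectralRadius, spectrum.of_subsingleton])
  obtain ⟨z, hz, hzr⟩ := spectrum.exists_nnnorm_eq_spectralRadius (M.map (algebraMap ℝ ℂ))
  rw [IsSchurStable, not_lt, ← hzr] at hM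
  rw [spectrum.mem_iff, isUnit_iff_isUnit_det, isUnit_iff_ne_zero, not_not,
    ← exists_vecMul_eq_zero_iff] at hz
  obtain ⟨v, hv0, hv⟩ := hz
  refine ⟨z, v, by exact_mod_cast hM, hv0, ?_⟩
  rw [vecMul_sub, Algebra.algebraMap_eq_smul_one, vecMul_smul, vecMul_one, sub_eq_zero] at hv
  exact hv.symm

theorem exists_weight_of_not_isSchurStable (hM : ¬ IsSchurStable M) :
    ∃ W : Matrix (Fin n) (Fin n) ℝ, W.PosSemidef ∧ W ≠ 0 ∧ W ≤ Mᵀ * W * M := by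
  obtain ⟨z, v, hz, hv0, hv⟩ := exists_vecMul_eq_smul_of_not_isSchurStable hM
  set a : Fin n → ℝ := fun i => (v i).re
  set b : Fin n → ℝ := fun i => (v i).im
  have ha : a ᵥ* M = z.re • a - z.im • b := by
    ext j
    simpa [vecMul, dotProduct, a, b] using congrArg Complex.re (congrFun hv j)
  have hb : b ᵥ* M = z.re • b + z.im • a := by
    ext j
    simpa [vecMul, dotProduct, a, b] using congrArg Complex.im (congrFun hv j)
  have hconj (x : Fin n → ℝ) :
      Mᵀ * vecMulVec x x * M = vecMulVec (x ᵥ* M) (x ᵥ* M) := by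
    rw [mul_vecMulVec, vecMulVec_mul, mulVec_transpose]
  have hW : (vecMulVec a a + vecMulVec b b).PosSemidef :=
    (posSemidef_vecMulVec_self_star a).add (posSemidef_vecMulVec_self_star b)
  have hMW : Mᵀ * (vecMulVec a a + vecMulVec b b) * M =
      ‖z‖ ^ 2 • (vecMulVec a a + vecMulVec b b) := by
    rw [Matrix.mul_add, Matrix.add_mul, hconj, hconj, ha, hb, ← Complex.normSq_eq_norm_sq]
    ext i j
    simp [vecMulVec_apply, Complex.normSq_apply]
    ring
  refine ⟨_, hW, fun h0 => hv0 ?_, ?_⟩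
  · funext i
    have hi := congrFun (congrFun h0 i) i
    simp only [Matrix.add_apply, vecMulVec_apply, Matrix.zero_apply] at hi
    exact Complex.ext (show a i = 0 by nlinarith) (show b i = 0 by nlinarith)
  · rw [hMW]
    simpa using smul_le_smul_of_nonneg_right (one_le_pow₀ hz : 1 ≤ ‖z‖ ^ 2) hW.nonneg

theorem IsSchurStable.eq_zero_of_le_transpose_mul_mul (hM : IsSchurStable M)
    {W : Matrix (Fin n) (Fin n) ℝ} (hW : W.PosSemidef) (hle : W ≤ Mᵀ * W * M) : W = 0 := by
  have hpow (k : ℕ) : W ≤ (M ^ k)ᵀ * W * M ^ k := by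
    induction k with
    | zero => simp
    | succ k ih =>
      have hstep := mul_mul_transpose_mono ih Mᵀ
      rw [transpose_transpose] at hstep
      simpa only [pow_succ, transpose_mul, Matrix.mul_assoc] using hle.trans hstep
  have hcont : Continuous fun X : Matrix (Fin n) (Fin n) ℝ => Xᵀ * W * X := by fun_prop
  have hlim : Tendsto (fun k : ℕ => (M ^ k)ᵀ * W * M ^ k) atTop (𝓝 0) := by
    simpa [Function.comp_def] using (hcont.tendsto 0).comp hM.tendsto_pow
  exact le_antisymm (ge_of_tendsto' hlim hpow) hW.nonneg

theorem IsSchurStable.exists_posSemidef_eq_mul_mul_transpose_add (hM : IsSchurStable M)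
    (hN : N.PosSemidef) :
    ∃ H : Matrix (Fin n) (Fin n) ℝ, H.PosSemidef ∧ H = M * H * Mᵀ + N := by
  set f : ℕ → Matrix (Fin n) (Fin n) ℝ := fun k => M ^ k * N * (M ^ k)ᵀ
  have hsumm : Summable f := by
    refine .of_norm_bounded_eventually_nat (hM.summable_norm_pow.mul_right ‖N‖) ?_
    filter_upwards [hM.summable_norm_pow.tendsto_atTop_zero.eventually_le_const one_pos] with k hk
    have htranspose : ‖(M ^ k)ᵀ‖ ≤ 1 := by
      rwa [← conjTranspose_eq_transpose_of_trivial, l2_opNorm_conjTranspose]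
    calc ‖f k‖ ≤ ‖M ^ k‖ * ‖N‖ * ‖(M ^ k)ᵀ‖ :=
          (norm_mul_le _ _).trans (by gcongr; exact norm_mul_le _ _)
      _ ≤ ‖M ^ k‖ * ‖N‖ := mul_le_of_le_one_right (by positivity) htranspose
  refine ⟨∑' k, f k, (tsum_nonneg fun k => (posSemidef_mul_mul_transpose hN _).nonneg).posSemidef,
    ?_⟩
  calc ∑' k, f k = f 0 + ∑' k, M * f k * Mᵀ := by
        rw [hsumm.tsum_eq_zero_add]
        simp only [f, pow_succ', transpose_mul, Matrix.mul_assoc]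
    _ = M * (∑' k, f k) * Mᵀ + N := by
        rw [(hsumm.mul_left M).tsum_mul_right, hsumm.tsum_mul_left, add_comm]
        simp [f]

theorem IsSchurStable.exists_lyapunov (hM : IsSchurStable M) :
    ∃ H : Matrix (Fin n) (Fin n) ℝ, 1 ≤ H ∧
      ∃ θ : ℝ, 0 < θ ∧ θ < 1 ∧ ∀ᶠ X in 𝓝 M, Xᵀ * H * X ≤ θ • H := by
  obtain ⟨H, hH, hstein⟩ := hM.transpose.exists_posSemidef_eq_mul_mul_transpose_add PosSemidef.one
  rw [transpose_transpose] at hstein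
  set h : ℝ := ‖H‖ + 1
  have hh : 1 ≤ h := le_add_of_nonneg_left (norm_nonneg H)
  have hHh : (2 * h)⁻¹ • H ≤ (2⁻¹ : ℝ) • 1 := by
    have : H ≤ h • 1 := (le_norm_smul_one hH.isHermitian).trans
      (smul_le_smul_of_nonneg_right (le_add_of_nonneg_right zero_le_one) zero_le_one)
    refine (smul_le_smul_of_nonneg_left this (by positivity)).trans_eq ?_
    rw [smul_smul]
    congr 1
    field_simp
  refine ⟨H, ?_, 1 - (2 * h)⁻¹, ?_, ?_, ?_⟩
  · rw [hstein]
    exact le_add_of_nonneg_left (posSemidef_transpose_mul_mul hH M).nonneg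
  · have : (2 * h)⁻¹ ≤ 2⁻¹ := by gcongr; linarith
    linarith
  · have : 0 < (2 * h)⁻¹ := by positivity
    linarith
  · have hcont : Continuous fun X : Matrix (Fin n) (Fin n) ℝ => ‖Xᵀ * H * X - Mᵀ * H * M‖ := by
      fun_prop
    have hnhds : ∀ᶠ X in 𝓝 M, ‖Xᵀ * H * X - Mᵀ * H * M‖ < 2⁻¹ :=
      (hcont.tendsto M).eventually_lt_const (by simp)
    filter_upwards [hnhds] with X hX
    have hherm : (Xᵀ * H * X - Mᵀ * H * M).IsHermitian :=
      (posSemidef_transpose_mul_mul hH X).isHermitian.sub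
        (posSemidef_transpose_mul_mul hH M).isHermitian
    calc Xᵀ * H * X = (Xᵀ * H * X - Mᵀ * H * M) + Mᵀ * H * M := by abel
      _ ≤ (2⁻¹ : ℝ) • 1 + Mᵀ * H * M := by
        gcongr
        exact (le_norm_smul_one hherm).trans (smul_le_smul_of_nonneg_right hX.le zero_le_one)
      _ = H - (2⁻¹ : ℝ) • 1 := by
        nth_rw 2 [hstein]
        module
      _ ≤ H - (2 * h)⁻¹ • H := by gcongr
      _ = (1 - (2 * h)⁻¹) • H := by module

theorem isSchurStable_of_isStabilizable_of_eq_add {m : ℕ} {N : Matrix (Fin n) (Fin m) ℝ}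
    {P : Matrix (Fin n) (Fin n) ℝ} (hMN : IsStabilizable M N) (hP : P.PosSemidef)
    (hfix : P = M * P * Mᵀ + N * Nᵀ) : IsSchurStable M := by
  by_contra hM
  obtain ⟨W, hW, hW0, hle⟩ := exists_weight_of_not_isSchurStable hM
  have htrace : (W * P).trace = (Mᵀ * W * M * P).trace + (W * (N * Nᵀ)).trace := by
    rw [← trace_mul_mul_mul_transpose, ← trace_add, ← Matrix.mul_add, ← hfix]
  have hWN : W * N = 0 := by
    refine mul_eq_zero_of_trace_mul_mul_transpose_eq_zero hW (le_antisymm ?_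
      (trace_mul_nonneg hW (posSemidef_mul_transpose_self N)))
    have hmono := trace_mul_mono hP hle
    rw [Matrix.trace_mul_comm, Matrix.trace_mul_comm P] at hmono
    linarith
  obtain ⟨G, hG⟩ := hMN
  have hNW : Nᵀ * W = 0 := by
    have hWt : Wᵀ = W := hW.isHermitian
    rw [← hWt, ← transpose_mul, hWN, transpose_zero]
  have hfeedback : (M - N * G)ᵀ * W * (M - N * G) = Mᵀ * W * M := by
    have hleft : (M - N * G)ᵀ * W = Mᵀ * W := by
      rw [transpose_sub, transpose_mul, Matrix.sub_mul, Matrix.mul_assoc, hNW, Matrix.mul_zero,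
        sub_zero]
    rw [hleft, Matrix.mul_sub, Matrix.mul_assoc Mᵀ W (N * G), ← Matrix.mul_assoc W, hWN,
      Matrix.zero_mul, Matrix.mul_zero, sub_zero]
  exact hW0 (hG.eq_zero_of_le_transpose_mul_mul hW (hle.trans_eq hfeedback.symm))

end SchurStability

section ExponentialConvergence

variable {n : ℕ} {X Y : ℕ → Matrix (Fin n) (Fin n) ℝ} {P Q : Matrix (Fin n) (Fin n) ℝ}

theorem ConvergesExponentially.summable_norm_sub (h : ConvergesExponentially X P) :
    Summable fun k => ‖X k - P‖ := by
  obtain ⟨c, ρ, -, hρ0, hρ1, hbound⟩ := h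
  exact .of_nonneg_of_le (fun _ => norm_nonneg _) hbound
    ((summable_geometric_of_lt_one hρ0 hρ1).mul_left c)

theorem ConvergesExponentially.tendsto (h : ConvergesExponentially X P) :
    Tendsto X atTop (𝓝 P) :=
  tendsto_iff_norm_sub_tendsto_zero.mpr h.summable_norm_sub.tendsto_atTop_zero

theorem ConvergesExponentially.sub (hX : ConvergesExponentially X P)
    (hY : ConvergesExponentially Y Q) : ConvergesExponentially (fun k => X k - Y k) (P - Q) := by
  obtain ⟨c, ρ, hc, hρ0, hρ1, hbX⟩ := hX
  obtain ⟨d, σ, hd, hσ0, hσ1, hbY⟩ := hY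
  refine ⟨c + d, max ρ σ, add_nonneg hc hd, le_max_of_le_left hρ0, max_lt hρ1 hσ1, fun k => ?_⟩
  calc ‖X k - Y k - (P - Q)‖ = ‖(X k - P) - (Y k - Q)‖ := by congr 1; abel
    _ ≤ c * ρ ^ k + d * σ ^ k := (norm_sub_le _ _).trans (add_le_add (hbX k) (hbY k))
    _ ≤ c * max ρ σ ^ k + d * max ρ σ ^ k := by
      gcongr
      exacts [le_max_left _ _, le_max_right _ _]
    _ = (c + d) * max ρ σ ^ k := by ring

theorem exists_le_mul_pow_of_eventually_le {u : ℕ → ℝ} {θ : ℝ} (hθ : 0 < θ)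
    (hu : ∀ᶠ k in atTop, u (k + 1) ≤ θ * u k) : ∃ c, 0 ≤ c ∧ ∀ k, u k ≤ c * θ ^ k := by
  obtain ⟨k₀, hk₀⟩ := eventually_atTop.mp hu
  have hratio : ∀ k ≥ k₀, u k / θ ^ k ≤ u k₀ / θ ^ k₀ := by
    intro k hk
    induction k, hk using Nat.le_induction with
    | base => rfl
    | succ k hk ih =>
      refine le_trans ?_ ih
      rw [pow_succ', div_le_div_iff₀ (by positivity) (by positivity)]
      calc u (k + 1) * θ ^ k ≤ θ * u k * θ ^ k := by gcongr; exact hk₀ k hk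
        _ = u k * (θ * θ ^ k) := by ring
  obtain ⟨c, hc⟩ := (isBoundedUnder_of_eventually_le
    (eventually_atTop.mpr ⟨k₀, hratio⟩)).bddAbove_range
  refine ⟨max c 0, le_max_right _ _, fun k => ?_⟩
  rw [← div_le_iff₀ (by positivity)]
  exact (hc ⟨k, rfl⟩).trans (le_max_left _ _)

theorem IsSchurStable.convergesExponentially_zero_of_le {M : Matrix (Fin n) (Fin n) ℝ}
    (hM : IsSchurStable M) {L : ℕ → Matrix (Fin n) (Fin n) ℝ} (hL : Tendsto L atTop (𝓝 M))
    (hX : ∀ k, (X k).PosSemidef) (hstep : ∀ k, X (k + 1) ≤ L k * X k * (L k)ᵀ) :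
    ConvergesExponentially X 0 := by
  obtain ⟨H, hH, θ, hθ0, hθ1, hcontr⟩ := hM.exists_lyapunov
  have hHpsd : H.PosSemidef := (zero_le_one.trans hH).posSemidef
  have hdecay : ∀ᶠ k in atTop, (H * X (k + 1)).trace ≤ θ * (H * X k).trace := by
    filter_upwards [hL.eventually hcontr] with k hk
    calc (H * X (k + 1)).trace ≤ (H * (L k * X k * (L k)ᵀ)).trace :=
          trace_mul_mono hHpsd (hstep k)
      _ = (X k * ((L k)ᵀ * H * L k)).trace := by
          rw [trace_mul_mul_mul_transpose, Matrix.trace_mul_comm]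
      _ ≤ (X k * (θ • H)).trace := trace_mul_mono (hX k) hk
      _ = θ * (H * X k).trace := by
          rw [Matrix.mul_smul, trace_smul, Matrix.trace_mul_comm, smul_eq_mul]
  obtain ⟨c, hc, hbound⟩ := exists_le_mul_pow_of_eventually_le
    (u := fun k => (H * X k).trace) hθ0 hdecay
  refine ⟨c, θ, hc, hθ0.le, hθ1, fun k => ?_⟩
  calc ‖X k - 0‖ ≤ (X k * 1).trace := by simpa using norm_le_trace (hX k)
    _ ≤ (X k * H).trace := trace_mul_mono (hX k) hH
    _ = (H * X k).trace := Matrix.trace_mul_comm _ _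
    _ ≤ c * θ ^ k := hbound k

theorem eq_zero_of_le_one_add_mul_of_tendsto_zero {d ε : ℕ → ℝ} (hd : ∀ k, 0 ≤ d k)
    (hε : ∀ k, 0 ≤ ε k) (hsumm : Summable ε) (hle : ∀ k, d k ≤ (1 + ε k) * d (k + 1))
    (hlim : Tendsto d atTop (𝓝 0)) : d 0 = 0 := by
  have hprod (k : ℕ) : d 0 ≤ (∏ j ∈ Finset.range k, (1 + ε j)) * d k := by
    induction k with
    | zero => simp
    | succ k ih =>
      rw [Finset.prod_range_succ, mul_assoc]
      exact ih.trans (mul_le_mul_of_nonneg_left (hle k)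
        (Finset.prod_nonneg fun j _ => add_nonneg zero_le_one (hε j)))
  have hbound (k : ℕ) : d 0 ≤ Real.exp (∑' j, ε j) * d k := by
    refine (hprod k).trans (mul_le_mul_of_nonneg_right ?_ (hd k))
    refine (Real.prod_one_add_le_exp_sum _ hε).trans (Real.exp_le_exp.mpr ?_)
    exact hsumm.sum_le_tsum _ fun j _ => hε j
  have hlim' : Tendsto (fun k => Real.exp (∑' j, ε j) * d k) atTop (𝓝 0) := by
    simpa using hlim.const_mul _
  exact le_antisymm (ge_of_tendsto' hlim' hbound) (hd 0)

end ExponentialConvergence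

section Reachability

variable {n m q : ℕ} {A : Matrix (Fin n) (Fin n) ℝ} {B : Matrix (Fin n) (Fin m) ℝ}

/-- `IsReachableIn A B k N`: the columns of `N` are states that the system `x ↦ A x + B u` can
reach from the origin in `k` steps, that is, `N = B T₀ + A B T₁ + ⋯ + A ^ (k - 1) B Tₖ₋₁`. -/
def IsReachableIn (A : Matrix (Fin n) (Fin n) ℝ) (B : Matrix (Fin n) (Fin m) ℝ) :
    ℕ → Matrix (Fin n) (Fin q) ℝ → Prop
  | 0, N => N = 0
  | k + 1, N => ∃ (T : Matrix (Fin m) (Fin q) ℝ) (L : Matrix (Fin n) (Fin q) ℝ),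
      IsReachableIn A B k L ∧ N = B * T + A * L

theorem IsReachableIn.mul_right {k : ℕ} {N : Matrix (Fin n) (Fin q) ℝ}
    (h : IsReachableIn A B k N) {l : ℕ} (X : Matrix (Fin q) (Fin l) ℝ) :
    IsReachableIn A B k (N * X) := by
  induction k generalizing N with
  | zero => rw [show N = 0 from h, Matrix.zero_mul]; rfl
  | succ k ih =>
    obtain ⟨T, L, hL, rfl⟩ := h
    exact ⟨T * X, L * X, ih hL, by simp only [Matrix.add_mul, Matrix.mul_assoc]⟩

theorem IsReachableIn.add {k : ℕ} {N N' : Matrix (Fin n) (Fin q) ℝ}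
    (h : IsReachableIn A B k N) (h' : IsReachableIn A B k N') :
    IsReachableIn A B k (N + N') := by
  induction k generalizing N N' with
  | zero => rw [show N = 0 from h, show N' = 0 from h', add_zero]; rfl
  | succ k ih =>
    obtain ⟨T, L, hL, rfl⟩ := h
    obtain ⟨T', L', hL', rfl⟩ := h'
    exact ⟨T + T', L + L', ih hL hL', by simp only [Matrix.mul_add]; abel⟩

theorem isReachableIn_zero (k : ℕ) : IsReachableIn A B k (0 : Matrix (Fin n) (Fin q) ℝ) := by
  induction k with
  | zero => rfl
  | succ k ih => exact ⟨0, 0, ih, by simp⟩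

theorem isReachableIn_input (k : ℕ) (T : Matrix (Fin m) (Fin q) ℝ) :
    IsReachableIn A B (k + 1) (B * T) :=
  ⟨T, 0, isReachableIn_zero k, by simp⟩

theorem eventually_isUnit_one_sub_inv_smul (L : Matrix (Fin n) (Fin n) ℝ) :
    ∀ᶠ t : ℝ in 𝓝[≠] 1, IsUnit (1 - t⁻¹ • L) := by
  have hroot : ∀ᶠ t : ℝ in 𝓝[≠] 1, ¬ L.charpoly.IsRoot t :=
    nhdsNE_le_cofinite 1
      (Polynomial.finite_setOfPred_isRoot L.charpoly_monic.ne_zero).eventually_cofinite_notMem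
  have hne : ∀ᶠ t : ℝ in 𝓝[≠] 1, t ≠ 0 :=
    (eventually_ne_nhds one_ne_zero).filter_mono nhdsWithin_le_nhds
  filter_upwards [hne, hroot] with t ht0 ht
  have hscalar : 1 - t⁻¹ • L = t⁻¹ • (scalar (Fin n) t - L) := by
    rw [smul_sub, scalar_apply, ← smul_one_eq_diagonal, smul_smul, inv_mul_cancel₀ ht0, one_smul]
  rw [isUnit_iff_isUnit_det, hscalar, det_smul, ← eval_charpoly, isUnit_iff_ne_zero]
  exact mul_ne_zero (pow_ne_zero _ (inv_ne_zero ht0)) ht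

theorem isStabilizable_of_isReachableIn_succ {k : ℕ} {N : Matrix (Fin n) (Fin n) ℝ}
    (hN : IsReachableIn A B (k + 1) N) (hs : IsSchurStable (A - N)) : IsStabilizable A B := by
  induction k generalizing N with
  | zero =>
    obtain ⟨T, L, hL, rfl⟩ := hN
    exact ⟨T, by rwa [show L = 0 from hL, Matrix.mul_zero, add_zero] at hs⟩
  | succ k ih =>
    obtain ⟨T, L, hL, rfl⟩ := hN
    -- `A - N = A * (1 - L) - B * T`. If `1 - L` were invertible, conjugating by it would turn this
    -- into `A` minus columns reachable in one step less; scaling `L` makes it invertible.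
    have hcont : ContinuousAt (fun t : ℝ => A * (1 - t⁻¹ • L) - B * T) 1 := by
      have : ContinuousAt (fun t : ℝ => t⁻¹) 1 := continuousAt_inv₀ one_ne_zero
      fun_prop
    have hs_one : IsSchurStable (A * (1 - (1 : ℝ)⁻¹ • L) - B * T) := by
      convert hs using 1
      simp only [inv_one, one_smul, Matrix.mul_sub, Matrix.mul_one]
      abel
    have hs_near : ∀ᶠ t : ℝ in 𝓝[≠] 1, IsSchurStable (A * (1 - t⁻¹ • L) - B * T) :=
      (hcont.eventually hs_one.eventually_nhds).filter_mono nhdsWithin_le_nhds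
    obtain ⟨t, ht, hU⟩ := (hs_near.and (eventually_isUnit_one_sub_inv_smul L)).exists
    set U : Matrix (Fin n) (Fin n) ℝ := 1 - t⁻¹ • L
    set G : Matrix (Fin m) (Fin n) ℝ := T * U⁻¹
    have hGU : B * G * U = B * T := by
      rw [Matrix.mul_assoc, Matrix.mul_assoc,
        Matrix.nonsing_inv_mul _ ((isUnit_iff_isUnit_det _).mp hU), Matrix.mul_one]
    refine ih (N := B * G + L * (t⁻¹ • (A - B * G))) ((isReachableIn_input k G).add
      (hL.mul_right _)) (ht.of_similar hU ?_)
    rw [← hGU, ← Matrix.sub_mul, ← Matrix.mul_assoc]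
    congr 1
    simp only [U, Matrix.sub_mul, Matrix.one_mul, Matrix.mul_smul, Matrix.smul_mul]
    abel

end Reachability

section Riccati

variable {n p r : ℕ} {A : Matrix (Fin n) (Fin n) ℝ} {B : Matrix (Fin n) (Fin r) ℝ}
  {C : Matrix (Fin p) (Fin n) ℝ} {D : Matrix (Fin p) (Fin r) ℝ} {P X : Matrix (Fin n) (Fin n) ℝ}

/-- The Riccati map `P ↦ A P Aᵀ + Q - K(P) R(P) K(P)ᵀ` of the noise covariances `Q = B Bᵀ`,
`S = B Dᵀ` and `R = D Dᵀ`; the error covariances are its orbits. -/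
noncomputable def riccati (A : Matrix (Fin n) (Fin n) ℝ) (B : Matrix (Fin n) (Fin r) ℝ)
    (C : Matrix (Fin p) (Fin n) ℝ) (D : Matrix (Fin p) (Fin r) ℝ)
    (P : Matrix (Fin n) (Fin n) ℝ) : Matrix (Fin n) (Fin n) ℝ :=
  A * P * Aᵀ + B * Bᵀ -
    gain A C (B * Dᵀ) (D * Dᵀ) P * innovationCov C (D * Dᵀ) P * (gain A C (B * Dᵀ) (D * Dᵀ) P)ᵀ

/-- The cross-covariance after one step of the errors of the two observers with gains `F` and
`G`, when both errors start with covariance `P`. For `F = G` it is the error covariance of a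
single observer with a suboptimal gain (the Joseph form). -/
def crossStep (A : Matrix (Fin n) (Fin n) ℝ) (B : Matrix (Fin n) (Fin r) ℝ)
    (C : Matrix (Fin p) (Fin n) ℝ) (D : Matrix (Fin p) (Fin r) ℝ) (F G : Matrix (Fin n) (Fin p) ℝ)
    (P : Matrix (Fin n) (Fin n) ℝ) : Matrix (Fin n) (Fin n) ℝ :=
  (A - F * C) * P * (A - G * C)ᵀ + (B - F * D) * (B - G * D)ᵀ

local notation "𝒦" => gain A C (B * Dᵀ) (D * Dᵀ)
local notation "𝒱" => innovationCov C (D * Dᵀ)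
local notation "ℰ" => errorCov A C (B * Bᵀ) (B * Dᵀ) (D * Dᵀ)

theorem posDef_innovationCov {R : Matrix (Fin p) (Fin p) ℝ} (hR : R.PosDef)
    (hP : P.PosSemidef) : (innovationCov C R P).PosDef :=
  PosDef.posSemidef_add (posSemidef_mul_mul_transpose hP C) hR

theorem gain_mul_innovationCov {S : Matrix (Fin n) (Fin p) ℝ} {R : Matrix (Fin p) (Fin p) ℝ}
    (hR : R.PosDef) (hP : P.PosSemidef) :
    gain A C S R P * innovationCov C R P = A * P * Cᵀ + S :=
  nonsing_inv_mul_cancel_right _ _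
    ((isUnit_iff_isUnit_det _).mp (posDef_innovationCov hR hP).isUnit)

theorem gain_sub_eq (hR : (D * Dᵀ).PosDef) (hP : P.PosSemidef) (F : Matrix (Fin n) (Fin p) ℝ) :
    𝒦 P - F = ((A - F * C) * P * Cᵀ + (B - F * D) * Dᵀ) * (𝒱 P)⁻¹ := by
  have hdet := (isUnit_iff_isUnit_det _).mp (posDef_innovationCov (C := C) hR hP).isUnit
  have hmul : (𝒦 P - F) * 𝒱 P = (A - F * C) * P * Cᵀ + (B - F * D) * Dᵀ := by
    rw [Matrix.sub_mul, gain_mul_innovationCov hR hP, innovationCov]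
    simp only [Matrix.sub_mul, Matrix.mul_add, Matrix.mul_assoc]
    abel
  rw [← hmul, mul_nonsing_inv_cancel_right _ _ hdet]

theorem crossStep_sub (F G : Matrix (Fin n) (Fin p) ℝ) :
    crossStep A B C D F G X - crossStep A B C D F G P = (A - F * C) * (X - P) * (A - G * C)ᵀ := by
  simp only [crossStep, Matrix.mul_sub, Matrix.sub_mul]
  abel

theorem crossStep_eq_riccati_add (hR : (D * Dᵀ).PosDef) (hP : P.PosSemidef)
    (F G : Matrix (Fin n) (Fin p) ℝ) :
    crossStep A B C D F G P = riccati A B C D P + (F - 𝒦 P) * 𝒱 P * (G - 𝒦 P)ᵀ := by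
  have hV : (𝒱 P)ᵀ = 𝒱 P := (posDef_innovationCov hR hP).isHermitian
  have hPt : Pᵀ = P := hP.isHermitian
  have hKV : 𝒦 P * 𝒱 P = A * P * Cᵀ + B * Dᵀ := gain_mul_innovationCov hR hP
  have hVK : 𝒱 P * (𝒦 P)ᵀ = C * P * Aᵀ + D * Bᵀ := by
    rw [← hV, ← transpose_mul, hKV]
    simp only [transpose_add, transpose_mul, transpose_transpose, hPt, Matrix.mul_assoc]
  calc crossStep A B C D F G P
      = A * P * Aᵀ + B * Bᵀ - F * (C * P * Aᵀ + D * Bᵀ) - (A * P * Cᵀ + B * Dᵀ) * Gᵀ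
          + F * 𝒱 P * Gᵀ := by
        simp only [crossStep, innovationCov, transpose_sub, transpose_mul, Matrix.mul_sub,
          Matrix.sub_mul, Matrix.mul_add, Matrix.add_mul, Matrix.mul_assoc]
        abel
    _ = riccati A B C D P + (F - 𝒦 P) * 𝒱 P * (G - 𝒦 P)ᵀ := by
        rw [← hKV, ← hVK, riccati]
        simp only [transpose_sub, Matrix.mul_sub, Matrix.sub_mul, Matrix.mul_assoc]
        abel

theorem riccati_eq_crossStep_gain (hR : (D * Dᵀ).PosDef) (hP : P.PosSemidef)
    (F : Matrix (Fin n) (Fin p) ℝ) : riccati A B C D P = crossStep A B C D F (𝒦 P) P := by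
  rw [crossStep_eq_riccati_add hR hP, sub_self, transpose_zero, Matrix.mul_zero, add_zero]

theorem riccati_le_crossStep (hR : (D * Dᵀ).PosDef) (hP : P.PosSemidef)
    (F : Matrix (Fin n) (Fin p) ℝ) : riccati A B C D P ≤ crossStep A B C D F F P := by
  rw [crossStep_eq_riccati_add hR hP]
  exact le_add_of_nonneg_right
    (posSemidef_mul_mul_transpose (posDef_innovationCov hR hP).posSemidef _).nonneg

theorem posSemidef_riccati (hR : (D * Dᵀ).PosDef) (hP : P.PosSemidef) :
    (riccati A B C D P).PosSemidef := by
  rw [riccati_eq_crossStep_gain hR hP (𝒦 P)]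
  exact (posSemidef_mul_mul_transpose hP _).add (posSemidef_mul_transpose_self _)

theorem riccati_sub_le (hR : (D * Dᵀ).PosDef) (hX : X.PosSemidef) (hP : P.PosSemidef) :
    riccati A B C D X - riccati A B C D P ≤ (A - 𝒦 P * C) * (X - P) * (A - 𝒦 P * C)ᵀ := by
  rw [← crossStep_sub (B := B) (D := D), ← riccati_eq_crossStep_gain hR hP]
  exact sub_le_sub_right (riccati_le_crossStep hR hX _) _

theorem riccati_sub_eq (hR : (D * Dᵀ).PosDef) (hX : X.PosSemidef) (hP : P.PosSemidef) :
    riccati A B C D X - riccati A B C D P =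
      (A - 𝒦 X * C) * (X - P) * (A - 𝒦 X * C)ᵀ + (𝒦 X - 𝒦 P) * 𝒱 P * (𝒦 X - 𝒦 P)ᵀ := by
  rw [← crossStep_sub (B := B) (D := D), ← riccati_eq_crossStep_gain hR hX,
    crossStep_eq_riccati_add hR hP]
  abel

theorem riccati_mono (hR : (D * Dᵀ).PosDef) (hX : X.PosSemidef) (h : X ≤ P) :
    riccati A B C D X ≤ riccati A B C D P := by
  rw [← sub_nonneg, riccati_sub_eq hR (hX.nonneg.trans h).posSemidef hX]
  exact ((posSemidef_mul_mul_transpose h _).add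
    (posSemidef_mul_mul_transpose (posDef_innovationCov hR hX).posSemidef _)).nonneg

theorem continuousAt_gain {S : Matrix (Fin n) (Fin p) ℝ} {R : Matrix (Fin p) (Fin p) ℝ}
    (hR : R.PosDef) (hP : P.PosSemidef) : ContinuousAt (gain A C S R) P := by
  have hinv : ContinuousAt (fun X => (innovationCov C R X)⁻¹) P := by
    obtain ⟨u, hu⟩ := (posDef_innovationCov (C := C) hR hP).isUnit
    have hcont : ContinuousAt (innovationCov C R) P := by
      unfold innovationCov
      fun_prop
    simp only [nonsing_inv_eq_ringInverse]
    exact ContinuousAt.comp (g := Ring.inverse) (hu ▸ NormedRing.inverse_continuousAt u) hcont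
  unfold gain
  fun_prop

theorem continuousAt_riccati (hR : (D * Dᵀ).PosDef) (hP : P.PosSemidef) :
    ContinuousAt (riccati A B C D) P := by
  have hgain : ContinuousAt 𝒦 P := continuousAt_gain hR hP
  unfold riccati innovationCov
  fun_prop

theorem solvesDARE_iff_riccati_eq (hR : (D * Dᵀ).PosDef) (hP : P.PosSemidef) :
    SolvesDARE A C (B * Bᵀ) (B * Dᵀ) (D * Dᵀ) P ↔ riccati A B C D P = P := by
  have hV : (𝒱 P)ᵀ = 𝒱 P := (posDef_innovationCov hR hP).isHermitian
  have hgain : (𝒦 P)ᵀ = (C * P * Cᵀ + D * Dᵀ)⁻¹ * (A * P * Cᵀ + B * Dᵀ)ᵀ := by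
    rw [gain, transpose_mul, transpose_nonsing_inv, hV, innovationCov]
  rw [SolvesDARE, riccati, gain_mul_innovationCov hR hP, hgain, ← Matrix.mul_assoc, eq_comm]

theorem posSemidef_errorCov (hR : (D * Dᵀ).PosDef) (hP : P.PosSemidef) (k : ℕ) :
    (ℰ P k).PosSemidef := by
  induction k with
  | zero => exact hP
  | succ k ih => exact posSemidef_riccati hR ih

theorem errorCov_eq_of_riccati_eq (h : riccati A B C D P = P) (k : ℕ) : ℰ P k = P := by
  induction k with
  | zero => rfl
  | succ k ih => exact (congrArg (riccati A B C D) ih).trans h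

theorem errorCov_mono (hR : (D * Dᵀ).PosDef) (hX : X.PosSemidef) (h : X ≤ P) (k : ℕ) :
    ℰ X k ≤ ℰ P k := by
  induction k with
  | zero => exact h
  | succ k ih => exact riccati_mono hR (posSemidef_errorCov hR hX k) ih

theorem monotone_errorCov_zero (hR : (D * Dᵀ).PosDef) : Monotone (ℰ 0) := by
  refine monotone_nat_of_le_succ fun k => ?_
  induction k with
  | zero => exact (posSemidef_errorCov hR .zero 1).nonneg
  | succ k ih => exact riccati_mono hR (posSemidef_errorCov hR .zero k) ih

theorem exists_tendsto_errorCov_zero (hR : (D * Dᵀ).PosDef) (hdet : IsDetectable A C) :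
    ∃ P, Tendsto (ℰ 0) atTop (𝓝 P) := by
  obtain ⟨L, hL⟩ := hdet
  obtain ⟨H, hH, hstein⟩ := hL.exists_posSemidef_eq_mul_mul_transpose_add
    (posSemidef_mul_transpose_self (B - L * D))
  refine exists_tendsto_of_monotone_of_le (monotone_errorCov_zero hR) (Y := H) fun k => ?_
  induction k with
  | zero => exact hH.nonneg
  | succ k ih =>
    calc ℰ 0 (k + 1) ≤ crossStep A B C D L L (ℰ 0 k) :=
          riccati_le_crossStep hR (posSemidef_errorCov hR .zero k) L
      _ ≤ crossStep A B C D L L H := by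
          unfold crossStep
          gcongr
          exact mul_mul_transpose_mono ih _
      _ = H := hstein.symm

theorem posSemidef_of_tendsto_errorCov (hR : (D * Dᵀ).PosDef) (hX : X.PosSemidef)
    (h : Tendsto (ℰ X) atTop (𝓝 P)) : P.PosSemidef :=
  (ge_of_tendsto' h fun k => (posSemidef_errorCov hR hX k).nonneg).posSemidef

theorem riccati_eq_of_tendsto_errorCov (hR : (D * Dᵀ).PosDef) (hX : X.PosSemidef)
    (h : Tendsto (ℰ X) atTop (𝓝 P)) : riccati A B C D P = P :=
  tendsto_nhds_unique
    ((continuousAt_riccati hR (posSemidef_of_tendsto_errorCov hR hX h)).tendsto.comp h)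
    (h.comp (tendsto_add_atTop_nat 1))

theorem tendsto_closedLoop_errorCov (hR : (D * Dᵀ).PosDef) (hX : X.PosSemidef)
    (h : Tendsto (ℰ X) atTop (𝓝 P)) :
    Tendsto (fun k => A - 𝒦 (ℰ X k) * C) atTop (𝓝 (A - 𝒦 P * C)) := by
  have hcont : ContinuousAt (fun Y => A - 𝒦 Y * C) P := by
    have hgain : ContinuousAt 𝒦 P :=
      continuousAt_gain hR (posSemidef_of_tendsto_errorCov hR hX h)
    fun_prop
  exact hcont.tendsto.comp h

theorem convergesExponentially_errorCov_sub_errorCov_zero (hR : (D * Dᵀ).PosDef)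
    (h : Tendsto (ℰ 0) atTop (𝓝 P)) (hs : IsSchurStable (A - 𝒦 P * C)) (hX : X.PosSemidef) :
    ConvergesExponentially (fun k => ℰ X k - ℰ 0 k) 0 :=
  hs.convergesExponentially_zero_of_le (tendsto_closedLoop_errorCov hR .zero h)
    (fun k => errorCov_mono hR .zero hX.nonneg k)
    (fun k => riccati_sub_le hR (posSemidef_errorCov hR hX k) (posSemidef_errorCov hR .zero k))

theorem convergesExponentially_errorCov (hR : (D * Dᵀ).PosDef)
    (h : Tendsto (ℰ 0) atTop (𝓝 P)) (hs : IsSchurStable (A - 𝒦 P * C)) (hX : X.PosSemidef) :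
    ConvergesExponentially (ℰ X) P := by
  have hP := posSemidef_of_tendsto_errorCov hR .zero h
  have hfix := riccati_eq_of_tendsto_errorCov hR .zero h
  simpa [ConvergesExponentially, errorCov_eq_of_riccati_eq hfix] using
    (convergesExponentially_errorCov_sub_errorCov_zero hR h hs hX).sub
      (convergesExponentially_errorCov_sub_errorCov_zero hR h hs hP)

theorem eq_of_riccati_eq_of_tendsto_errorCov_zero (hR : (D * Dᵀ).PosDef)
    (h : Tendsto (ℰ 0) atTop (𝓝 P)) (hs : IsSchurStable (A - 𝒦 P * C)) (hX : X.PosSemidef)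
    (hfix : riccati A B C D X = X) : X = P :=
  tendsto_nhds_unique (tendsto_const_nhds.congr fun k => (errorCov_eq_of_riccati_eq hfix k).symm)
    (convergesExponentially_errorCov hR h hs hX).tendsto

theorem isReachableIn_errorCov_zero (hR : (D * Dᵀ).PosDef) (F : Matrix (Fin n) (Fin p) ℝ)
    (k : ℕ) : IsReachableIn (A - F * C) (B - F * D) k (ℰ 0 k) := by
  induction k with
  | zero => rfl
  | succ k ih =>
    refine ⟨(B - 𝒦 (ℰ 0 k) * D)ᵀ, _, ih.mul_right (A - 𝒦 (ℰ 0 k) * C)ᵀ, ?_⟩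
    calc ℰ 0 (k + 1) = crossStep A B C D F (𝒦 (ℰ 0 k)) (ℰ 0 k) :=
          riccati_eq_crossStep_gain hR (posSemidef_errorCov hR .zero k) F
      _ = _ := by rw [crossStep, add_comm, Matrix.mul_assoc]

theorem isReachableIn_gain_sub (hR : (D * Dᵀ).PosDef) (F : Matrix (Fin n) (Fin p) ℝ) (k : ℕ) :
    IsReachableIn (A - F * C) (B - F * D) (k + 1) (𝒦 (ℰ 0 k) - F) := by
  rw [gain_sub_eq hR (posSemidef_errorCov hR .zero k)]
  have hN : IsReachableIn (A - F * C) (B - F * D) (k + 1)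
      ((A - F * C) * ℰ 0 k * Cᵀ + (B - F * D) * Dᵀ) :=
    ⟨Dᵀ, _, (isReachableIn_errorCov_zero hR F k).mul_right Cᵀ, by
      rw [add_comm, Matrix.mul_assoc (A - F * C)]⟩
  exact hN.mul_right _

theorem isStabilizable_of_tendsto_errorCov_zero (hR : (D * Dᵀ).PosDef)
    (h : Tendsto (ℰ 0) atTop (𝓝 P)) (hs : IsSchurStable (A - 𝒦 P * C))
    (F : Matrix (Fin n) (Fin p) ℝ) : IsStabilizable (A - F * C) (B - F * D) := by
  obtain ⟨k, hk⟩ :=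
    ((tendsto_closedLoop_errorCov hR .zero h).eventually hs.eventually_nhds).exists
  refine isStabilizable_of_isReachableIn_succ ((isReachableIn_gain_sub hR F k).mul_right C) ?_
  rwa [Matrix.sub_mul, sub_sub_sub_cancel_right]

theorem closedLoop_conj_sub_le (hR : (D * Dᵀ).PosDef) (hX : X.PosSemidef) (hP : P.PosSemidef)
    (hPX : P ≤ X) {ε : ℝ} (hε : 0 < ε) (h : C * (X - P) * Cᵀ ≤ ε • 𝒱 P) :
    (A - 𝒦 P * C) * (X - P) * (A - 𝒦 P * C)ᵀ ≤
      (1 + ε) • (riccati A B C D X - riccati A B C D P) := by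
  set N := 𝒦 X - 𝒦 P with hN
  have hclosedLoop : A - 𝒦 P * C = (A - 𝒦 X * C) + N * C := by
    rw [hN, Matrix.sub_mul]
    abel
  have hNC : ε⁻¹ • (N * C * (X - P) * (N * C)ᵀ) ≤ N * 𝒱 P * Nᵀ := by
    rw [inv_smul_le_iff_of_pos hε]
    simpa only [transpose_mul, Matrix.mul_smul, Matrix.smul_mul, Matrix.mul_assoc] using
      mul_mul_transpose_mono h N
  rw [riccati_sub_eq hR hX hP, hclosedLoop]
  refine (add_mul_mul_transpose_add_le hPX _ _ hε).trans ?_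
  gcongr

theorem exists_summable_conj_sub_le_smul_innovationCov (hR : (D * Dᵀ).PosDef) (hP : P.PosSemidef)
    {X : ℕ → Matrix (Fin n) (Fin n) ℝ} (hPX : ∀ k, P ≤ X k) (hX : ConvergesExponentially X P) :
    ∃ ε : ℕ → ℝ, (∀ k, 0 < ε k) ∧ Summable ε ∧ ∀ k, C * (X k - P) * Cᵀ ≤ ε k • 𝒱 P := by
  obtain ⟨κ, hκ, hone⟩ := exists_pos_one_le_smul (posDef_innovationCov (C := C) hR hP)
  -- The geometric term only serves to make every `ε k` positive.
  refine ⟨fun k => (‖C * (X k - P) * Cᵀ‖ + (1 / 2) ^ k) * κ, fun k => by positivity, ?_,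
    fun k => ?_⟩
  · refine (Summable.add (.of_nonneg_of_le (fun _ => norm_nonneg _) (fun k => ?_)
      ((hX.summable_norm_sub.mul_left ‖C‖).mul_right ‖Cᵀ‖)) summable_geometric_two).mul_right κ
    exact (l2_opNorm_mul _ _).trans (by gcongr; exact l2_opNorm_mul _ _)
  · have hherm := (posSemidef_mul_mul_transpose (hPX k) C).isHermitian
    calc C * (X k - P) * Cᵀ ≤ ‖C * (X k - P) * Cᵀ‖ • 1 := le_norm_smul_one hherm
      _ ≤ (‖C * (X k - P) * Cᵀ‖ + (1 / 2) ^ k) • 1 :=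
        smul_le_smul_of_nonneg_right (le_add_of_nonneg_right (by positivity)) zero_le_one
      _ ≤ _ := by
        rw [mul_smul]
        exact smul_le_smul_of_nonneg_left hone (by positivity)

theorem isSchurStable_of_convergesExponentially_errorCov (hR : (D * Dᵀ).PosDef)
    (hP : P.PosSemidef) (hfix : riccati A B C D P = P)
    (hconv : ConvergesExponentially (ℰ (P + 1)) P) : IsSchurStable (A - 𝒦 P * C) := by
  by_contra hM
  obtain ⟨W, hW, hW0, hWM⟩ := exists_weight_of_not_isSchurStable hM
  have hP1 : P ≤ P + 1 := le_add_of_nonneg_right zero_le_one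
  have hP1psd : (P + 1).PosSemidef := hP.add .one
  have hPX (k : ℕ) : P ≤ ℰ (P + 1) k :=
    (errorCov_eq_of_riccati_eq hfix k).symm.trans_le (errorCov_mono hR hP hP1 k)
  obtain ⟨ε, hε, hsumm, hle⟩ :=
    exists_summable_conj_sub_le_smul_innovationCov (C := C) hR hP hPX hconv
  set d : ℕ → ℝ := fun k => (W * (ℰ (P + 1) k - P)).trace
  have hstep (k : ℕ) : d k ≤ (1 + ε k) * d (k + 1) := by
    have hconj := closedLoop_conj_sub_le (A := A) (B := B) hR (posSemidef_errorCov hR hP1psd k) hP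
      (hPX k) (hε k) (hle k)
    rw [hfix] at hconj
    calc d k = ((ℰ (P + 1) k - P) * W).trace := Matrix.trace_mul_comm _ _
      _ ≤ ((ℰ (P + 1) k - P) * ((A - 𝒦 P * C)ᵀ * W * (A - 𝒦 P * C))).trace :=
          trace_mul_mono (hPX k) hWM
      _ = (W * ((A - 𝒦 P * C) * (ℰ (P + 1) k - P) * (A - 𝒦 P * C)ᵀ)).trace := by
          rw [trace_mul_mul_mul_transpose, Matrix.trace_mul_comm]
      _ ≤ (W * ((1 + ε k) • (ℰ (P + 1) (k + 1) - P))).trace := trace_mul_mono hW hconj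
      _ = (1 + ε k) * d (k + 1) := by rw [Matrix.mul_smul, trace_smul, smul_eq_mul]
  have hlim : Tendsto d atTop (𝓝 0) := by
    have hcont : Continuous fun Y => (W * (Y - P)).trace := by fun_prop
    simpa [Function.comp_def] using (hcont.tendsto P).comp hconv.tendsto
  have hd0 : d 0 = 0 := eq_zero_of_le_one_add_mul_of_tendsto_zero
    (fun k => trace_mul_nonneg hW (hPX k)) (fun k => (hε k).le) hsumm hstep hlim
  refine hW0 (hW.trace_eq_zero_iff.mp ?_)
  simpa [d, errorCov] using hd0

theorem isSchurStable_of_isStabilizable_closedLoop (hR : (D * Dᵀ).PosDef) (hP : P.PosSemidef)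
    (hfix : riccati A B C D P = P) (hstab : IsStabilizable (A - 𝒦 P * C) (B - 𝒦 P * D)) :
    IsSchurStable (A - 𝒦 P * C) :=
  isSchurStable_of_isStabilizable_of_eq_add hstab hP
    (hfix.symm.trans (riccati_eq_crossStep_gain hR hP (𝒦 P)))

theorem exists_isUniqueStabilizingSolution_and_errorCovConvergesTo (hR : (D * Dᵀ).PosDef)
    (hdet : IsDetectable A C)
    (hstab : ∀ F : Matrix (Fin n) (Fin p) ℝ, IsStabilizable (A - F * C) (B - F * D)) :
    ∃ P, IsUniqueStabilizingSolution A C (B * Bᵀ) (B * Dᵀ) (D * Dᵀ) P ∧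
      ErrorCovConvergesTo A C (B * Bᵀ) (B * Dᵀ) (D * Dᵀ) P := by
  obtain ⟨P, hlim⟩ := exists_tendsto_errorCov_zero (B := B) hR hdet
  have hP := posSemidef_of_tendsto_errorCov hR .zero hlim
  have hfix := riccati_eq_of_tendsto_errorCov hR .zero hlim
  have hs := isSchurStable_of_isStabilizable_closedLoop hR hP hfix (hstab _)
  exact ⟨P, ⟨hP, (solvesDARE_iff_riccati_eq hR hP).mpr hfix, hs, fun X hX hDARE =>
      eq_of_riccati_eq_of_tendsto_errorCov_zero hR hlim hs hX
        ((solvesDARE_iff_riccati_eq hR hX).mp hDARE)⟩,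
    fun _ hX => convergesExponentially_errorCov hR hlim hs hX⟩

theorem IsUniqueStabilizingSolution.isDetectable_and_isStabilizable (hR : (D * Dᵀ).PosDef)
    (h : IsUniqueStabilizingSolution A C (B * Bᵀ) (B * Dᵀ) (D * Dᵀ) P) :
    IsDetectable A C ∧
      ∀ F : Matrix (Fin n) (Fin p) ℝ, IsStabilizable (A - F * C) (B - F * D) := by
  obtain ⟨-, -, hs, huniq⟩ := h
  have hdet : IsDetectable A C := ⟨_, hs⟩
  obtain ⟨X, hlim⟩ := exists_tendsto_errorCov_zero (B := B) hR hdet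
  have hX := posSemidef_of_tendsto_errorCov hR .zero hlim
  have hXP : X = P := huniq X hX
    ((solvesDARE_iff_riccati_eq hR hX).mpr (riccati_eq_of_tendsto_errorCov hR .zero hlim))
  exact ⟨hdet, isStabilizable_of_tendsto_errorCov_zero hR (hXP ▸ hlim) hs⟩

theorem ErrorCovConvergesTo.isDetectable_and_isStabilizable (hR : (D * Dᵀ).PosDef)
    (h : ErrorCovConvergesTo A C (B * Bᵀ) (B * Dᵀ) (D * Dᵀ) P) :
    IsDetectable A C ∧
      ∀ F : Matrix (Fin n) (Fin p) ℝ, IsStabilizable (A - F * C) (B - F * D) := by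
  have hlim := (h 0 .zero).tendsto
  have hP := posSemidef_of_tendsto_errorCov hR .zero hlim
  have hfix := riccati_eq_of_tendsto_errorCov hR .zero hlim
  have hs : IsSchurStable (A - 𝒦 P * C) :=
    isSchurStable_of_convergesExponentially_errorCov hR hP hfix (h (P + 1) (hP.add .one))
  exact ⟨⟨_, hs⟩, isStabilizable_of_tendsto_errorCov_zero hR hlim hs⟩

end Riccati

end KalmanFilter

theorem mainTheorem7_general {n p r : ℕ}
    (A : Matrix (Fin n) (Fin n) ℝ) (C : Matrix (Fin p) (Fin n) ℝ)
    (Q : Matrix (Fin n) (Fin n) ℝ) (S : Matrix (Fin n) (Fin p) ℝ)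
    (R : Matrix (Fin p) (Fin p) ℝ) (hR : R.PosDef)
    (B : Matrix (Fin n) (Fin r) ℝ) (D : Matrix (Fin p) (Fin r) ℝ)
    (hfact : Matrix.fromBlocks Q S S.transpose R =
      Matrix.fromRows B D * (Matrix.fromRows B D).transpose) :
    [ ∃ P, KalmanFilter.IsUniqueStabilizingSolution A C Q S R P,
      ∃ P, KalmanFilter.ErrorCovConvergesTo A C Q S R P,
      KalmanFilter.IsDetectable A C ∧
        ∀ F : Matrix (Fin n) (Fin p) ℝ,
          KalmanFilter.IsStabilizable (A - F * C) (B - F * D) ].TFAE ∧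
    ∀ P, KalmanFilter.IsUniqueStabilizingSolution A C Q S R P →
      KalmanFilter.ErrorCovConvergesTo A C Q S R P := by
  rw [transpose_fromRows, fromRows_mul_fromCols, fromBlocks_inj] at hfact
  obtain ⟨rfl, rfl, -, rfl⟩ := hfact
  have hboth (h : KalmanFilter.IsDetectable A C ∧
      ∀ F : Matrix (Fin n) (Fin p) ℝ, KalmanFilter.IsStabilizable (A - F * C) (B - F * D)) :=
    KalmanFilter.exists_isUniqueStabilizingSolution_and_errorCovConvergesTo hR h.1 h.2
  constructor
  · tfae_have 1 → 3 := fun ⟨_, h⟩ => h.isDetectable_and_isStabilizable hR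
    tfae_have 2 → 3 := fun ⟨_, h⟩ => h.isDetectable_and_isStabilizable hR
    tfae_have 3 → 1 := fun h => (hboth h).imp fun _ => And.left
    tfae_have 3 → 2 := fun h => (hboth h).imp fun _ => And.right
    tfae_finish
  · intro P hP
    obtain ⟨P', hP', hconv⟩ := hboth (hP.isDetectable_and_isStabilizable hR)
    rwa [hP.2.2.2 P' hP'.1 hP'.2.1] at hconv

theorem mainTheorem7 {n p r : ℕ}
    (A : Matrix (Fin n) (Fin n) ℝ) (C : Matrix (Fin p) (Fin n) ℝ)
    (Q : Matrix (Fin n) (Fin n) ℝ) (S : Matrix (Fin n) (Fin p) ℝ)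
    (R : Matrix (Fin p) (Fin p) ℝ) (hR : R.PosDef)
    (B : Matrix (Fin n) (Fin r) ℝ) (D : Matrix (Fin p) (Fin r) ℝ)
    (hfact : Matrix.fromBlocks Q S S.transpose R =
      Matrix.fromRows B D * (Matrix.fromRows B D).transpose)
    (hrank : (Matrix.fromRows B D).rank = r) :
    [ ∃ P, KalmanFilter.IsUniqueStabilizingSolution A C Q S R P,
      ∃ P, KalmanFilter.ErrorCovConvergesTo A C Q S R P,
      KalmanFilter.IsDetectable A C ∧
        ∀ F : Matrix (Fin n) (Fin p) ℝ,
          KalmanFilter.IsStabilizable (A - F * C) (B - F * D) ].TFAE ∧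
    ∀ P, KalmanFilter.IsUniqueStabilizingSolution A C Q S R P →
      KalmanFilter.ErrorCovConvergesTo A C Q S R P :=
  mainTheorem7_general A C Q S R hR B D hfact
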